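/- **Setting.** Let $F$ be a number field with adele ring $\mathbb A$ and (finite) class group $C$, let $n$ be a natural number and $\mathbb F$ a field. For $\delta\in\mathrm{GL}_n(\mathbb A)$ let $(\det\delta)$ be the fractional ideal $\prod_{\mathfrak p}\mathfrak p^{\mathrm{ord}_{\mathfrak p}(\det\delta)_{\mathfrak p}}$ and $[\det\delta]\in C$ its class. Let $K$ be a subgroup and $\Delta$ a subsemigroup of $\mathrm{GL}_n(\mathbb A)$ with $K\Delta K=\Delta$ and with $K$ commensurable to $\delta K\delta^{-1}$ for every $\delta\in\Delta$ (a Hecke pair), and suppose that $(\det\kappa)$ is principal for every $\kappa\in K$. For subgroups $\Gamma,\Gamma'$ of a group and a subset $D$ with $\Gamma D\Gamma'=D$, let $R(\Gamma,\Gamma',D)$ be the group of finite sums $\sum_j a_j\Gamma\delta_j$ ($a_j\in\mathbb Z$, $\delta_j\in D$) of right cosets that are invariant under right multiplication by $\Gamma'$. Then $R(K,\Delta)=R(K,K,\Delta)$ is a ring (unital if $K\subseteq\Delta$, not necessarily unital otherwise) under $(\sum_j a_jK\delta_j)(\sum_i a'_iK\delta'_i)=\sum_{i,j} a_ja'_iK\delta_j\delta'_i$;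 it is spanned by the double cosets $K\delta K$, $\delta\in\Delta$. A *system of eigenvalues* is a ring homomorphism $\Phi:R(K,\Delta)\to\mathbb F$ (additive and multiplicative). Let $\varepsilon\in\{1,-1\}$, and for every $c\in C$ let $\alpha_c\in\mathrm{GL}_n(\mathbb A)$ with $[\det\alpha_c]=c^{\varepsilon}$. Suppose that the determinant $\bigcup_{c\in C}\alpha_c\mathrm{GL}_n(F)K\to\mathrm{GL}_1(\mathbb A)$ is surjective. Put $\Gamma_c=\alpha_c^{-1}K\alpha_c\cap\mathrm{GL}_n(F)$ and $\Delta_{c,c'}=\alpha_c^{-1}\Delta\alpha_{c'}\cap\mathrm{GL}_n(F)$. Let $S\subseteq\mathrm{GL}_n(F)$ be a monoid containing all $\Gamma_c$ and all $\Delta_{c,c'}$, and let $V$ be an $\mathbb F$-vector space with an $\mathbb F$-linear right action of $S$. Cohomology is computed by homogeneous cochains $f:\Gamma^{i+1}\to V$, $f(\eta\gamma_0,\dots,\eta\gamma_i)=f(\gamma_0,\dots,\gamma_i)\eta^{-1}$. An element $\sum_j a_j\Gamma_{c'}\delta_j\in R(\Gamma_{c'},\Gamma_{c},\Delta_{c',c})$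 maps $H^i(\Gamma_{c'},V)$ to $H^i(\Gamma_{c},V)$ by $f\mapsto f'$, $f'(\gamma_0,\dots,\gamma_i)=\sum_j a_jf(t_j(\gamma_0),\dots,t_j(\gamma_i))\delta_j$, where $t_j(\gamma)\in\Gamma_{c'}$ is determined by $t_j(\gamma)\delta_r=\delta_j\gamma$ for some $r$. The algebra $R(K,\Delta)$ acts on $\bigoplus_{c\in C}H^i(\Gamma_c,V)$ as follows: for $T=\sum_j a_jK\delta_j$ the component of $f|T$ in $H^i(\Gamma_c,V)$ is $\sum_{c'\in C}f_{c'}|T_{c',c}$, where $T_{c',c}=\sum_j a_j\,(\alpha_{c'}^{-1}K\delta_j\alpha_c\cap\Delta_{c',c})\in R(\Gamma_{c'},\Gamma_c,\Delta_{c',c})$. An *eigenform* for $\Phi$ is a non-zero $f\in\bigoplus_cH^i(\Gamma_c,V)$ with $f|T=\Phi(T)f$ for all $T\in R(K,\Delta)$, and $\Phi$ *occurs* in $\bigoplus_cH^i(\Gamma_c,V)$ if it has an eigenform. **Proposition.** Let $i\ge 0$, let $\chi:C\to\mathbb F^*$ be a homomorphism, and let $\Phi$ be a system of eigenvalues that occurs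 in $\bigoplus_{c\in C}H^i(\Gamma_c,V)$. Then there is a system of eigenvalues $\chi\otimes\Phi:R(K,\Delta)\to\mathbb F$ with $$(\chi\otimes\Phi)(K\delta K)=\chi([\det\delta])\,\Phi(K\delta K)\qquad\text{for all }\delta\in\Delta,$$ and $\chi\otimes\Phi$ also occurs in $\bigoplus_{c\in C}H^i(\Gamma_c,V)$. More precisely, if $f=(f_c)_{c\in C}$ is an eigenform for $\Phi$, then $f^\chi=(\chi(c)^{\varepsilon}f_c)_{c\in C}$ is an eigenform for $\chi\otimes\Phi$. -/

import Mathlib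

open scoped Pointwise

noncomputable section

namespace AdelicHecke

/-! ### Double cosets -/

section DoubleCosets

variable {G : Type*} [Group G]

/-- The set `Γ\G` of cosets `Γ g`. -/
abbrev Cosets (Γ : Subgroup G) : Type _ := Quotient (QuotientGroup.rightRel Γ)

/-- The coset `Γ g`. -/
abbrev coset (Γ : Subgroup G) (g : G) : Cosets Γ := Quotient.mk (QuotientGroup.rightRel Γ) g

theorem exists_of_finsum_ne_zero {ι : Type*} {f : ι → ℤ} (h : ∑ᶠ x, f x ≠ 0) : ∃ x, f x ≠ 0 := by
  by_contra! h'
  exact h (by simp [h'])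

theorem coset_eq_iff {Γ : Subgroup G} {g h : G} : coset Γ g = coset Γ h ↔ h * g⁻¹ ∈ Γ := by
  rw [Quotient.eq, QuotientGroup.rightRel_apply]

theorem coset_out (Γ : Subgroup G) (x : Cosets Γ) : coset Γ x.out = x := Quotient.out_eq x

theorem out_coset_mul_inv (Γ : Subgroup G) (g : G) : g * (coset Γ g).out⁻¹ ∈ Γ :=
  coset_eq_iff.1 (coset_out Γ (coset Γ g))

/-- Right translation `Γ g ↦ Γ g a` on `Γ\G`. -/
def translate (Γ : Subgroup G) (a : G) : Cosets Γ ≃ Cosets Γ where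
  toFun := Quotient.map (· * a) fun g h hgh => by
    rw [← Quotient.eq_iff_equiv, coset_eq_iff] at hgh ⊢
    simpa [mul_assoc] using hgh
  invFun := Quotient.map (· * a⁻¹) fun g h hgh => by
    rw [← Quotient.eq_iff_equiv, coset_eq_iff] at hgh ⊢
    simpa [mul_assoc] using hgh
  left_inv x := by induction x using Quotient.inductionOn; simp
  right_inv x := by induction x using Quotient.inductionOn; simp

theorem translate_coset (Γ : Subgroup G) (a g : G) :
    translate Γ a (coset Γ g) = coset Γ (g * a) := rfl

theorem translate_translate (Γ : Subgroup G) (a b : G) (x : Cosets Γ) :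
    translate Γ b (translate Γ a x) = translate Γ (a * b) x := by
  induction x using Quotient.inductionOn
  simp [translate_coset, mul_assoc]

theorem translate_eq (Γ : Subgroup G) (a : G) (x : Cosets Γ) :
    translate Γ a x = coset Γ (x.out * a) := by
  conv_lhs => rw [← coset_out Γ x]
  rfl

/-- `R(Γ, Γ', Δ)`: finite `ℤ`-linear combinations `∑ a_j Γ δ_j` of cosets contained in `Δ` that are
invariant under right multiplication by `Γ'`. Such a combination is recorded by the function `T` on
`G` for which `T g` is the coefficient of the coset `Γ g`. -/
def heckeModule (Γ Γ' : Subgroup G) (Δ : Set G) : AddSubgroup (G → ℤ) where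
  carrier := {T | (∀ γ ∈ Γ, ∀ g, T (γ * g) = T g) ∧ (∀ g, ∀ γ ∈ Γ', T (g * γ) = T g) ∧
    (∀ g, T g ≠ 0 → g ∈ Δ) ∧ (coset Γ '' {g | T g ≠ 0}).Finite}
  zero_mem' := by simp
  add_mem' := by
    rintro S T ⟨hS1, hS2, hS3, hS4⟩ ⟨hT1, hT2, hT3, hT4⟩
    have key : ∀ g, (S + T) g ≠ 0 → S g ≠ 0 ∨ T g ≠ 0 := by
      intro g h
      by_contra! h'
      simp [h'.1, h'.2] at h
    refine ⟨fun γ hγ g => ?_, fun g γ hγ => ?_, fun g hg => ?_, ?_⟩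
    · simp [hS1 γ hγ g, hT1 γ hγ g]
    · simp [hS2 g γ hγ, hT2 g γ hγ]
    · exact (key g hg).elim (hS3 g) (hT3 g)
    · refine (hS4.union hT4).subset ?_
      rintro _ ⟨g, hg, rfl⟩
      exact (key g hg).imp (fun h => ⟨g, h, rfl⟩) (fun h => ⟨g, h, rfl⟩)
  neg_mem' := by
    rintro T ⟨hT1, hT2, hT3, hT4⟩
    refine ⟨fun γ hγ g => ?_, fun g γ hγ => ?_, fun g hg => ?_, ?_⟩
    · simp [hT1 γ hγ g]
    · simp [hT2 g γ hγ]
    · exact hT3 g (by simpa using hg)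
    · simpa using hT4

namespace heckeModule

variable {Γ Γ' : Subgroup G} {Δ : Set G} (T : heckeModule Γ Γ' Δ)

theorem left_inv {γ : G} (hγ : γ ∈ Γ) (g : G) : T.1 (γ * g) = T.1 g := T.2.1 γ hγ g

theorem right_inv {γ : G} (hγ : γ ∈ Γ') (g : G) : T.1 (g * γ) = T.1 g := T.2.2.1 g γ hγ

theorem mem_of_ne_zero {g : G} (h : T.1 g ≠ 0) : g ∈ Δ := T.2.2.2.1 g h

theorem eq_of_coset_eq {g h : G} (hgh : coset Γ g = coset Γ h) : T.1 g = T.1 h := by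
  have := left_inv T (coset_eq_iff.1 hgh) g
  simpa using this.symm

theorem apply_out (g : G) : T.1 (coset Γ g).out = T.1 g := eq_of_coset_eq T (coset_out Γ _)

/-- The finite set of cosets that occur in `T` with non-zero coefficient. -/
def support : Finset (Cosets Γ) := T.2.2.2.2.toFinset

theorem mem_support {x : Cosets Γ} : x ∈ support T ↔ T.1 x.out ≠ 0 := by
  simp only [support, Set.Finite.mem_toFinset, Set.mem_image]
  constructor
  · rintro ⟨g, hg, rfl⟩
    rwa [apply_out]
  · exact fun h => ⟨x.out, h, coset_out Γ x⟩

end heckeModule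

/-- `(K, Δ)` is a Hecke pair: `Δ` is a semigroup with `K Δ K = Δ`, and `K` is commensurable to
`δ K δ⁻¹` for all `δ ∈ Δ`. -/
structure IsHeckePair (K : Subgroup G) (Δ : Subsemigroup G) : Prop where
  left_mem : ∀ κ ∈ K, ∀ δ ∈ Δ, κ * δ ∈ Δ
  right_mem : ∀ δ ∈ Δ, ∀ κ ∈ K, δ * κ ∈ Δ
  commensurable : ∀ δ ∈ Δ, K.Commensurable (MulAut.conj δ • K)

/-- The double coset algebra `R(K, Δ) = R(K, K, Δ)` of a subgroup `K` and a semigroup `Δ`. -/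
def HeckeAlgebra (K : Subgroup G) (Δ : Subsemigroup G) : Type _ := heckeModule K K (Δ : Set G)

namespace HeckeAlgebra

variable {K : Subgroup G} {Δ : Subsemigroup G}

instance : AddCommGroup (HeckeAlgebra K Δ) :=
  inferInstanceAs (AddCommGroup (heckeModule K K (Δ : Set G)))

/-- The coefficient function of an element of `R(K, Δ)`. -/
def coeff (T : HeckeAlgebra K Δ) : G → ℤ := T.1

theorem ext {S T : HeckeAlgebra K Δ} (h : ∀ g, S.coeff g = T.coeff g) : S = T :=
  Subtype.ext (funext h)

/-- The coefficient function of the product `∑ a_j a'_i K δ_j δ'_i` of `T = ∑ a_j K δ_j` and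
`T' = ∑ a'_i K δ'_i`: as `K δ_j δ'_i = K g` means `K δ_j = K g δ'_i⁻¹`, the coefficient of `K g` is
the sum over `i` of `a'_i` times the coefficient of `K g δ'_i⁻¹` in `T`. -/
def mulCoeff (T T' : HeckeAlgebra K Δ) (g : G) : ℤ :=
  ∑ᶠ x : Cosets K, T.coeff (g * x.out⁻¹) * T'.coeff x.out

theorem coeff_left (T : HeckeAlgebra K Δ) {κ : G} (h : κ ∈ K) (g : G) :
    T.coeff (κ * g) = T.coeff g := T.2.1 κ h g

theorem coeff_right (T : HeckeAlgebra K Δ) {κ : G} (h : κ ∈ K) (g : G) :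
    T.coeff (g * κ) = T.coeff g := T.2.2.1 g κ h

theorem coeff_congr (T : HeckeAlgebra K Δ) {g h : G} (hgh : coset K g = coset K h) :
    T.coeff g = T.coeff h := heckeModule.eq_of_coset_eq (Γ := K) (Γ' := K) T hgh

theorem mul_congr (T T' : HeckeAlgebra K Δ) (g : G) {h h' : G} (hh : coset K h = coset K h') :
    T.coeff (g * h⁻¹) * T'.coeff h = T.coeff (g * h'⁻¹) * T'.coeff h' := by
  have h1 := coset_eq_iff.1 hh.symm
  rw [T'.coeff_congr hh, ← T.coeff_right h1 (g * h⁻¹)]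
  congr 2
  group

theorem finite_cosets (T : HeckeAlgebra K Δ) (a : G) :
    {x : Cosets K | T.coeff (x.out * a) ≠ 0}.Finite := by
  refine Set.Finite.subset (T.2.2.2.2.preimage ((translate K a).injective.injOn)) ?_
  intro x hx
  exact ⟨x.out * a, hx, (translate_eq K a x).symm⟩

theorem finite_support_mul (T T' : HeckeAlgebra K Δ) (g : G) :
    (Function.support fun x : Cosets K => T.coeff (g * x.out⁻¹) * T'.coeff x.out).Finite := by
  refine (T'.finite_cosets 1).subset fun x hx => ?_
  simpa using right_ne_zero_of_mul hx

/-- Reindexing of the sum that defines the product. -/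
theorem mulCoeff_mul (T T' : HeckeAlgebra K Δ) (g a : G) :
    mulCoeff T T' (g * a) =
      ∑ᶠ x : Cosets K, T.coeff (g * x.out⁻¹) * T'.coeff (x.out * a) := by
  rw [mulCoeff, ← finsum_comp_equiv (translate K a)]
  refine finsum_congr fun x => ?_
  have := mul_congr T T' (g * a) (h := (translate K a x).out) (h' := x.out * a)
    (by rw [coset_out, translate_eq])
  rw [this]
  simp [mul_assoc]

instance : Mul (HeckeAlgebra K Δ) where
  mul T T' := ⟨mulCoeff T T', by
    refine ⟨fun κ hκ g => ?_, fun g κ hκ => ?_, fun g hg => ?_, ?_⟩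
    · refine finsum_congr fun x => ?_
      rw [mul_assoc, T.coeff_left hκ]
    · rw [mulCoeff_mul]
      refine finsum_congr fun x => ?_
      rw [T'.coeff_right hκ]
    · obtain ⟨x, hx⟩ := exists_of_finsum_ne_zero hg
      have h1 := heckeModule.mem_of_ne_zero (Γ := K) (Γ' := K) T (left_ne_zero_of_mul hx)
      have h2 := heckeModule.mem_of_ne_zero (Γ := K) (Γ' := K) T' (right_ne_zero_of_mul hx)
      simpa using Δ.mul_mem h1 h2
    · refine Set.Finite.subset ((T'.finite_cosets 1).biUnion
        fun x _ => (T.finite_cosets x.out⁻¹)) ?_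
      rintro _ ⟨g, hg, rfl⟩
      obtain ⟨x, hx⟩ := exists_of_finsum_ne_zero hg
      have h2 := right_ne_zero_of_mul hx
      have h1 := left_ne_zero_of_mul hx
      simp only [Set.mem_iUnion]
      refine ⟨x, by simpa using h2, ?_⟩
      have h3 : coset K ((coset K g).out * x.out⁻¹) = coset K (g * x.out⁻¹) := by
        rw [← translate_eq, translate_coset]
      simpa [T.coeff_congr h3] using h1⟩

theorem coeff_mul (T T' : HeckeAlgebra K Δ) (g : G) : (T * T').coeff g =
    ∑ᶠ x : Cosets K, T.coeff (g * x.out⁻¹) * T'.coeff x.out := rfl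

theorem coeff_mul' (T T' : HeckeAlgebra K Δ) (g a : G) : (T * T').coeff (g * a) =
    ∑ᶠ x : Cosets K, T.coeff (g * x.out⁻¹) * T'.coeff (x.out * a) := mulCoeff_mul T T' g a

theorem coeff_add (T T' : HeckeAlgebra K Δ) (g : G) :
    (T + T').coeff g = T.coeff g + T'.coeff g := rfl

theorem coeff_zero (g : G) : (0 : HeckeAlgebra K Δ).coeff g = 0 := rfl

instance : NonUnitalRing (HeckeAlgebra K Δ) where
  left_distrib T U W := ext fun g => by
    rw [coeff_add, coeff_mul, coeff_mul, coeff_mul,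
      ← finsum_add_distrib (finite_support_mul T U g) (finite_support_mul T W g)]
    exact finsum_congr fun x => by rw [coeff_add, mul_add]
  right_distrib T U W := ext fun g => by
    rw [coeff_add, coeff_mul, coeff_mul, coeff_mul,
      ← finsum_add_distrib (finite_support_mul T W g) (finite_support_mul U W g)]
    exact finsum_congr fun x => by rw [coeff_add, add_mul]
  zero_mul T := ext fun g => by simp [coeff_mul, coeff_zero]
  mul_zero T := ext fun g => by simp [coeff_mul, coeff_zero]
  mul_assoc T U W := ext fun g => by
    have hfin : (Function.support fun p : Cosets K × Cosets K =>
        T.coeff (g * p.2.out⁻¹) * U.coeff (p.2.out * p.1.out⁻¹) * W.coeff p.1.out).Finite := by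
      refine Set.Finite.subset ((W.finite_cosets 1).biUnion fun x _ =>
        (Set.finite_singleton x).prod (U.finite_cosets x.out⁻¹)) ?_
      rintro ⟨x, y⟩ hxy
      have h1 := right_ne_zero_of_mul hxy
      have h2 := right_ne_zero_of_mul (left_ne_zero_of_mul hxy)
      simp only [Set.mem_iUnion]
      exact ⟨x, by simpa using h1, by simpa using h2⟩
    calc ((T * U) * W).coeff g
        = ∑ᶠ x : Cosets K, ∑ᶠ y : Cosets K,
            T.coeff (g * y.out⁻¹) * U.coeff (y.out * x.out⁻¹) * W.coeff x.out := by
          rw [coeff_mul]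
          refine finsum_congr fun x => ?_
          rw [coeff_mul', finsum_mul]
      _ = ∑ᶠ y : Cosets K, ∑ᶠ x : Cosets K,
            T.coeff (g * y.out⁻¹) * U.coeff (y.out * x.out⁻¹) * W.coeff x.out := by
          rw [← finsum_curry _ hfin, ← finsum_comp_equiv (Equiv.prodComm _ _), finsum_curry]
          · rfl
          · exact hfin.preimage (Equiv.injective _).injOn
      _ = (T * (U * W)).coeff g := by
          rw [coeff_mul]
          refine finsum_congr fun y => ?_
          rw [coeff_mul, mul_finsum]
          exact finsum_congr fun x => mul_assoc _ _ _

/-- The double coset `K δ K`, as the sum of the cosets `K g` that it contains. -/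
def doubleCoset (h : IsHeckePair K Δ) {δ : G} (hδ : δ ∈ Δ) : HeckeAlgebra K Δ :=
  ⟨(DoubleCoset.doubleCoset δ (K : Set G) (K : Set G)).indicator 1, by
    have hmem : ∀ g, (DoubleCoset.doubleCoset δ (K : Set G) (K : Set G)).indicator (1 : G → ℤ) g ≠ 0
        → g ∈ DoubleCoset.doubleCoset δ (K : Set G) (K : Set G) :=
      fun g hg => Set.mem_of_indicator_ne_zero hg
    have hiff : ∀ g g', (g ∈ DoubleCoset.doubleCoset δ (K : Set G) (K : Set G) ↔
        g' ∈ DoubleCoset.doubleCoset δ (K : Set G) (K : Set G)) →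
        (DoubleCoset.doubleCoset δ (K : Set G) (K : Set G)).indicator (1 : G → ℤ) g =
        (DoubleCoset.doubleCoset δ (K : Set G) (K : Set G)).indicator (1 : G → ℤ) g' := by
      intro g g' hgg
      by_cases hg : g' ∈ DoubleCoset.doubleCoset δ (K : Set G) (K : Set G)
      · rw [Set.indicator_of_mem hg, Set.indicator_of_mem (hgg.2 hg)]; rfl
      · rw [Set.indicator_of_notMem hg, Set.indicator_of_notMem (hgg.not.2 hg)]
    refine ⟨fun κ hκ g => hiff _ _ ?_, fun g κ hκ => hiff _ _ ?_, fun g hg => ?_, ?_⟩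
    · simp only [DoubleCoset.mem_doubleCoset]
      constructor
      · rintro ⟨x, hx, y, hy, hxy⟩
        exact ⟨κ⁻¹ * x, K.mul_mem (K.inv_mem hκ) hx, y, hy, by
          rw [mul_assoc, mul_assoc, ← mul_assoc x, ← hxy]; simp⟩
      · rintro ⟨x, hx, y, hy, rfl⟩
        exact ⟨κ * x, K.mul_mem hκ hx, y, hy, by simp [mul_assoc]⟩
    · simp only [DoubleCoset.mem_doubleCoset]
      constructor
      · rintro ⟨x, hx, y, hy, hxy⟩
        exact ⟨x, hx, y * κ⁻¹, K.mul_mem hy (K.inv_mem hκ), by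
          rw [← mul_assoc, ← hxy]; simp⟩
      · rintro ⟨x, hx, y, hy, rfl⟩
        exact ⟨x, hx, y * κ, K.mul_mem hy hκ, by simp [mul_assoc]⟩
    · obtain ⟨x, hx, y, hy, rfl⟩ := DoubleCoset.mem_doubleCoset.1 (hmem g hg)
      exact h.right_mem _ (h.left_mem x hx δ hδ) y hy
    · have hrel : (K.subgroupOf (MulAut.conj δ • K)).index ≠ 0 := (h.commensurable δ hδ).1
      have : (K.subgroupOf (MulAut.conj δ • K)).FiniteIndex := ⟨hrel⟩
      refine (Set.finite_range fun q : (MulAut.conj δ • K : Subgroup G) ⧸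
        K.subgroupOf (MulAut.conj δ • K) => coset K ((q.out : G)⁻¹ * δ)).subset ?_
      rintro _ ⟨g, hg, rfl⟩
      obtain ⟨x, hx, y, hy, rfl⟩ := DoubleCoset.mem_doubleCoset.1 (hmem g hg)
      have hl : MulAut.conj δ y ∈ MulAut.conj δ • K :=
        Subgroup.smul_mem_pointwise_smul y (MulAut.conj δ) K hy
      let l : (MulAut.conj δ • K : Subgroup G) := ⟨MulAut.conj δ y, hl⟩
      refine ⟨QuotientGroup.mk l⁻¹, ?_⟩
      have hq := QuotientGroup.out_eq' (QuotientGroup.mk l⁻¹ :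
        (MulAut.conj δ • K : Subgroup G) ⧸ K.subgroupOf (MulAut.conj δ • K))
      rw [QuotientGroup.eq, Subgroup.mem_subgroupOf] at hq
      rw [coset_eq_iff]
      generalize (QuotientGroup.mk l⁻¹ :
        (MulAut.conj δ • K : Subgroup G) ⧸ K.subgroupOf (MulAut.conj δ • K)).out = q at hq ⊢
      have h1 : ((q⁻¹ * l⁻¹ : (MulAut.conj δ • K : Subgroup G)) : G) =
        (q : G)⁻¹ * (δ * y * δ⁻¹)⁻¹ := rfl
      rw [h1] at hq
      have h2 := K.mul_mem hx (K.inv_mem hq)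
      convert h2 using 1
      group⟩

end HeckeAlgebra

end DoubleCosets

/-! ### Group cohomology with right modules, and the Hecke operators on it

A right module `V` for a monoid `S` of elements of `G`, over the field `𝔽`, is a representation of
the opposite monoid `Sᵐᵒᵖ`. -/

section Cohomology

variable {G : Type*} [Group G] {𝔽 : Type*} [Field 𝔽] {V : Type*} [AddCommGroup V] [Module 𝔽 V]
  {S : Submonoid G}

open Classical in
/-- The right action `v ↦ v g` of `g ∈ S` on `V` (and the junk value `0` for `g ∉ S`). -/
def act (ρ : Representation 𝔽 (↥S)ᵐᵒᵖ V) (g : G) : V →ₗ[𝔽] V :=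
  if h : g ∈ S then ρ (MulOpposite.op ⟨g, h⟩) else 0

theorem act_mul (ρ : Representation 𝔽 (↥S)ᵐᵒᵖ V) {g h : G} (hg : g ∈ S) (hh : h ∈ S) (v : V) :
    act ρ (g * h) v = act ρ h (act ρ g v) := by
  rw [act, act, act, dif_pos hg, dif_pos hh, dif_pos (S.mul_mem hg hh), ← Module.End.mul_apply,
    ← map_mul]
  rfl

/-- All functions `Γ^(i+1) → V`. -/
abbrev Functions (Γ : Subgroup G) (V : Type*) (i : ℕ) : Type _ := (Fin (i + 1) → Γ) → V

/-- Homogeneous `i`-cochains: functions `f : Γ^(i+1) → V` such that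
`f (η γ₀, …, η γᵢ) = f (γ₀, …, γᵢ) η⁻¹`. -/
def cochains (Γ : Subgroup G) (ρ : Representation 𝔽 (↥S)ᵐᵒᵖ V) (i : ℕ) :
    Submodule 𝔽 (Functions Γ V i) where
  carrier := {f | ∀ (η : Γ) (γ : Fin (i + 1) → Γ),
    f (fun k => η * γ k) = act ρ ((η : G)⁻¹) (f γ)}
  zero_mem' := by simp
  add_mem' hf hg η γ := by simp [hf η γ, hg η γ]
  smul_mem' a f hf η γ := by simp [hf η γ]

/-- The coboundary `(df) (γ₀, …, γᵢ₊₁) = ∑ₖ (-1)ᵏ f (γ₀, …, γₖ omitted, …, γᵢ₊₁)`. -/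
def differential (𝔽 : Type*) [Field 𝔽] (V : Type*) [AddCommGroup V] [Module 𝔽 V]
    (Γ : Subgroup G) (i : ℕ) : Functions Γ V i →ₗ[𝔽] Functions Γ V (i + 1) :=
  LinearMap.pi fun γ => ∑ k : Fin (i + 2), (-1 : 𝔽) ^ (k : ℕ) •
    LinearMap.proj (fun l : Fin (i + 1) => γ (k.succAbove l))

theorem differential_apply (Γ : Subgroup G) (i : ℕ) (f : Functions Γ V i) (γ : Fin (i + 2) → Γ) :
    differential 𝔽 V Γ i f γ =
      ∑ k : Fin (i + 2), (-1 : 𝔽) ^ (k : ℕ) • f (fun l => γ (k.succAbove l)) := by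
  simp [differential, LinearMap.sum_apply]

/-- Homogeneous `i`-cocycles. -/
def cocycles (Γ : Subgroup G) (ρ : Representation 𝔽 (↥S)ᵐᵒᵖ V) (i : ℕ) :
    Submodule 𝔽 (Functions Γ V i) :=
  cochains Γ ρ i ⊓ LinearMap.ker (differential 𝔽 V Γ i)

/-- Homogeneous `i`-coboundaries. -/
def coboundaries (Γ : Subgroup G) (ρ : Representation 𝔽 (↥S)ᵐᵒᵖ V) :
    (i : ℕ) → Submodule 𝔽 (Functions Γ V i)
  | 0 => ⊥
  | i + 1 => (cochains Γ ρ i).map (differential 𝔽 V Γ i)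

/-- The cohomology group `Hⁱ(Γ, V)`, cocycles modulo coboundaries. -/
abbrev Cohomology (Γ : Subgroup G) (ρ : Representation 𝔽 (↥S)ᵐᵒᵖ V) (i : ℕ) : Type _ :=
  cocycles Γ ρ i ⧸ (coboundaries Γ ρ i).submoduleOf (cocycles Γ ρ i)

/-- Let `δ_x` be the chosen representatives of the cosets `x ∈ Γ\G`. This is the element
`t_x(γ') ∈ Γ` with `t_x(γ') δ_r = δ_x γ'` for some `r` (namely for the coset `r = x γ'`). -/
def transfer (Γ : Subgroup G) (x : Cosets Γ) (g : G) : Γ :=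
  ⟨x.out * g * (translate Γ g x).out⁻¹, by
    rw [translate_eq]
    exact out_coset_mul_inv Γ _⟩

theorem transfer_mul (Γ : Subgroup G) (x : Cosets Γ) (g h : G) :
    transfer Γ x (g * h) = transfer Γ x g * transfer Γ (translate Γ g x) h := by
  ext
  simp [transfer, translate_translate, mul_assoc]

variable {Γ Γ' : Subgroup G} {Δ : Set G}

/-- The operation of `T = ∑ a_j Γ δ_j` on functions:
`f'(γ'₀, …, γ'ᵢ) = ∑ a_j f(t_j(γ'₀), …, t_j(γ'ᵢ)) δ_j`, where `δ_j` runs through the chosen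
representatives of the cosets in `T`. (Another choice of representatives gives a map that is
homotopic to this one on cochains, hence the same map on cohomology.) -/
def heckeFun (ρ : Representation 𝔽 (↥S)ᵐᵒᵖ V) (T : heckeModule Γ Γ' Δ) (i : ℕ) :
    Functions Γ V i →ₗ[𝔽] Functions Γ' V i :=
  ∑ x ∈ heckeModule.support T, T.1 x.out • LinearMap.pi fun γ' : Fin (i + 1) → Γ' =>
    (act ρ x.out).comp (LinearMap.proj fun k => transfer Γ x (γ' k))

theorem heckeFun_apply (ρ : Representation 𝔽 (↥S)ᵐᵒᵖ V) (T : heckeModule Γ Γ' Δ) (i : ℕ)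
    (f : Functions Γ V i) (γ' : Fin (i + 1) → Γ') :
    heckeFun ρ T i f γ' = ∑ x ∈ heckeModule.support T,
      T.1 x.out • act ρ x.out (f fun k => transfer Γ x (γ' k)) := by
  simp [heckeFun, LinearMap.sum_apply]

theorem heckeFun_differential (ρ : Representation 𝔽 (↥S)ᵐᵒᵖ V) (T : heckeModule Γ Γ' Δ) (i : ℕ)
    (f : Functions Γ V i) :
    heckeFun ρ T (i + 1) (differential 𝔽 V Γ i f) =
      differential 𝔽 V Γ' i (heckeFun ρ T i f) := by
  ext γ'
  simp only [heckeFun_apply, differential_apply, map_sum, map_smul, Finset.smul_sum]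
  rw [Finset.sum_comm]
  exact Finset.sum_congr rfl fun k _ => Finset.sum_congr rfl fun x _ => smul_comm _ _ _

theorem heckeFun_mem_cochains (hΓ : ∀ g ∈ Γ, g ∈ S) (hΓ' : ∀ g ∈ Γ', g ∈ S) (hΔ : ∀ g ∈ Δ, g ∈ S)
    (ρ : Representation 𝔽 (↥S)ᵐᵒᵖ V) (T : heckeModule Γ Γ' Δ) (i : ℕ)
    {f : Functions Γ V i} (hf : f ∈ cochains Γ ρ i) : heckeFun ρ T i f ∈ cochains Γ' ρ i := by
  intro η γ'
  have hinv : ∀ x, T.1 (translate Γ η x).out = T.1 x.out := fun x => by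
    rw [translate_eq, heckeModule.apply_out, heckeModule.right_inv T η.2]
  rw [heckeFun_apply, heckeFun_apply, map_sum]
  refine Finset.sum_equiv (translate Γ (η : G)) ?_ ?_
  · intro x
    rw [heckeModule.mem_support, heckeModule.mem_support, hinv]
  · intro x hx
    rw [heckeModule.mem_support] at hx
    have h1 : x.out ∈ S := hΔ _ (heckeModule.mem_of_ne_zero T hx)
    have h2 : (translate Γ (η : G) x).out ∈ S :=
      hΔ _ (heckeModule.mem_of_ne_zero T (by rwa [hinv]))
    have h3 : ((η : G)⁻¹) ∈ S := hΓ' _ (Γ'.inv_mem η.2)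
    have h4 : ((transfer Γ x η : G)⁻¹) ∈ S := hΓ _ (Γ.inv_mem (transfer Γ x η).2)
    have h5 : (fun k => transfer Γ x ((η * γ' k : Γ') : G)) =
        fun k => transfer Γ x η * transfer Γ (translate Γ (η : G) x) (γ' k) := by
      ext k
      rw [Subgroup.coe_mul, transfer_mul]
    rw [h5, hf, map_zsmul, hinv, ← act_mul ρ h4 h1, ← act_mul ρ h2 h3]
    congr 3
    simp [transfer, mul_assoc]

/-- The map `f ↦ f | T` from `Hⁱ(Γ, V)` to `Hⁱ(Γ', V)` given by `T ∈ R(Γ, Γ', Δ)`, for a right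
module `V` of a monoid that contains `Γ`, `Γ'` and `Δ`. -/
def heckeOp (hΓ : ∀ g ∈ Γ, g ∈ S) (hΓ' : ∀ g ∈ Γ', g ∈ S) (hΔ : ∀ g ∈ Δ, g ∈ S)
    (ρ : Representation 𝔽 (↥S)ᵐᵒᵖ V) (T : heckeModule Γ Γ' Δ) (i : ℕ) :
    Cohomology Γ ρ i →ₗ[𝔽] Cohomology Γ' ρ i :=
  Submodule.mapQ _ _
    ((heckeFun ρ T i).restrict fun f hf => ⟨heckeFun_mem_cochains hΓ hΓ' hΔ ρ T i hf.1, by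
      change differential 𝔽 V Γ' i (heckeFun ρ T i f) = 0
      rw [← heckeFun_differential, LinearMap.mem_ker.1 hf.2, map_zero]⟩)
    (by
      rintro ⟨f, hf⟩ hfB
      change f ∈ coboundaries Γ ρ i at hfB
      change heckeFun ρ T i f ∈ coboundaries Γ' ρ i
      cases i with
      | zero =>
        rw [coboundaries, Submodule.mem_bot] at hfB ⊢
        rw [hfB, map_zero]
      | succ i =>
        obtain ⟨b, hb, rfl⟩ := hfB
        exact ⟨heckeFun ρ T i b, heckeFun_mem_cochains hΓ hΓ' hΔ ρ T i hb,
          (heckeFun_differential ρ T i b).symm⟩)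

end Cohomology

/-! ### The adelic Hecke algebra and its action -/

section Adelic

open NumberField IsDedekindDomain

variable {F : Type*} [Field F] [NumberField F] {n : ℕ}

/-- The fractional ideal `(x) = ∏_v v ^ ord_v(x_v)` of an idele `x`; it depends only on the finite
part of `x`. -/
def ideleIdeal (x : (AdeleRing (𝓞 F) F)ˣ) : (FractionalIdeal (nonZeroDivisors (𝓞 F)) F)ˣ :=
  ∏ᶠ v : HeightOneSpectrum (𝓞 F),
    (Units.mk0 (v.asIdeal : FractionalIdeal (nonZeroDivisors (𝓞 F)) F)
      (FractionalIdeal.coeIdeal_ne_zero.2 v.ne_bot)) ^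
        (-WithZero.log (Valued.v ((x : AdeleRing (𝓞 F) F).2 v)))

/-- The class of the fractional ideal `(det δ)` in the class group of `F`. -/
def detClass (δ : GL (Fin n) (AdeleRing (𝓞 F) F)) : ClassGroup (𝓞 F) :=
  ClassGroup.mk F (ideleIdeal (Matrix.GeneralLinearGroup.det δ))

/-- The diagonal embedding of `GL_n(F)` into `GL_n(𝔸)`. -/
abbrev diagGL (F : Type*) [Field F] [NumberField F] (n : ℕ) :
    GL (Fin n) F →* GL (Fin n) (AdeleRing (𝓞 F) F) :=
  Matrix.GeneralLinearGroup.map (algebraMap F (AdeleRing (𝓞 F) F))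

/-- `α⁻¹ K α ∩ GL_n(F)`. For `α = α_c` this is `Γ_c`. -/
def arithGroup (K : Subgroup (GL (Fin n) (AdeleRing (𝓞 F) F)))
    (α : GL (Fin n) (AdeleRing (𝓞 F) F)) : Subgroup (GL (Fin n) F) :=
  (K.comap (MulAut.conj α).toMonoidHom).comap (diagGL F n)

/-- `α⁻¹ Δ β ∩ GL_n(F)`. For `α = α_c`, `β = α_c'` this is `Δ_{c,c'}`. -/
def arithSet (Δ : Subsemigroup (GL (Fin n) (AdeleRing (𝓞 F) F)))
    (α β : GL (Fin n) (AdeleRing (𝓞 F) F)) : Set (GL (Fin n) F) :=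
  {g | α * diagGL F n g * β⁻¹ ∈ Δ}

variable {K : Subgroup (GL (Fin n) (AdeleRing (𝓞 F) F))}
  {Δ : Subsemigroup (GL (Fin n) (AdeleRing (𝓞 F) F))}

theorem mem_arithGroup {α : GL (Fin n) (AdeleRing (𝓞 F) F)} {g : GL (Fin n) F} :
    g ∈ arithGroup K α ↔ α * diagGL F n g * α⁻¹ ∈ K := Iff.rfl

/-- The image `∑ a_j (α⁻¹ K δ_j β ∩ α⁻¹ Δ β ∩ GL_n(F))` of `T = ∑ a_j K δ_j ∈ R(K, Δ)` in
`R(α⁻¹Kα ∩ GL_n(F), β⁻¹Kβ ∩ GL_n(F), α⁻¹Δβ ∩ GL_n(F))`. The coefficient of the coset of `g` in it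
is that of `K α g β⁻¹` in `T`. -/
def component (T : HeckeAlgebra K Δ) (α β : GL (Fin n) (AdeleRing (𝓞 F) F)) :
    heckeModule (arithGroup K α) (arithGroup K β) (arithSet Δ α β) :=
  ⟨fun g => T.coeff (α * diagGL F n g * β⁻¹), by
    refine ⟨fun γ hγ g => ?_, fun g γ hγ => ?_, fun g hg => ?_, ?_⟩
    · beta_reduce
      rw [← T.coeff_left (mem_arithGroup.1 hγ) (α * diagGL F n g * β⁻¹), map_mul]
      congr 1
      group
    · beta_reduce
      rw [← T.coeff_right (mem_arithGroup.1 hγ) (α * diagGL F n g * β⁻¹), map_mul]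
      congr 1
      group
    · exact heckeModule.mem_of_ne_zero (Γ := K) (Γ' := K) T hg
    · refine Set.Finite.of_finite_image (f := fun x : Cosets (arithGroup K α) =>
        coset K (α * diagGL F n x.out * β⁻¹)) (T.2.2.2.2.subset ?_) ?_
      · rintro _ ⟨_, ⟨g, hg, rfl⟩, rfl⟩
        refine ⟨α * diagGL F n g * β⁻¹, hg, ?_⟩
        rw [coset_eq_iff]
        have := coset_eq_iff.1 (coset_out (arithGroup K α) (coset _ g)).symm
        rw [mem_arithGroup, map_mul, map_inv] at this
        convert this using 1
        group
      · intro x _ y _ hxy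
        rw [coset_eq_iff] at hxy
        rw [← coset_out _ x, ← coset_out _ y, coset_eq_iff, mem_arithGroup, map_mul, map_inv]
        convert hxy using 1
        group⟩

variable {𝔽 : Type*} [Field 𝔽] {V : Type*} [AddCommGroup V] [Module 𝔽 V]
  {S : Submonoid (GL (Fin n) F)}

/-- `⨁_{c ∈ C} Hⁱ(Γ_c, V)`, where `C` is the (finite) class group of `F`. -/
abbrev TotalCohomology (K : Subgroup (GL (Fin n) (AdeleRing (𝓞 F) F)))
    (α : ClassGroup (𝓞 F) → GL (Fin n) (AdeleRing (𝓞 F) F))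
    (ρ : Representation 𝔽 (↥S)ᵐᵒᵖ V) (i : ℕ) : Type _ :=
  ∀ c : ClassGroup (𝓞 F), Cohomology (arithGroup K (α c)) ρ i

/-- The action `f ↦ f | T` of `T ∈ R(K, Δ)` on `⨁_c Hⁱ(Γ_c, V)`: the component of `f | T` at `c` is
the sum over `c'` of the images of `f_{c'}` under the components of `T` in
`R(Γ_{c'}, Γ_c, Δ_{c',c})`. -/
def heckeAction {α : ClassGroup (𝓞 F) → GL (Fin n) (AdeleRing (𝓞 F) F)}
    (hΓ : ∀ c, ∀ g ∈ arithGroup K (α c), g ∈ S)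
    (hΔ : ∀ c c', ∀ g ∈ arithSet Δ (α c) (α c'), g ∈ S)
    (ρ : Representation 𝔽 (↥S)ᵐᵒᵖ V) (i : ℕ) (T : HeckeAlgebra K Δ) :
    TotalCohomology K α ρ i →ₗ[𝔽] TotalCohomology K α ρ i :=
  LinearMap.pi fun c => ∑ c', (heckeOp (hΓ c') (hΓ c) (hΔ c' c) ρ
    (component T (α c') (α c)) i).comp (LinearMap.proj c')

/-- `f` is an eigenform with system of eigenvalues `Φ`. -/
def IsEigenform {α : ClassGroup (𝓞 F) → GL (Fin n) (AdeleRing (𝓞 F) F)}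
    (hΓ : ∀ c, ∀ g ∈ arithGroup K (α c), g ∈ S)
    (hΔ : ∀ c c', ∀ g ∈ arithSet Δ (α c) (α c'), g ∈ S)
    (ρ : Representation 𝔽 (↥S)ᵐᵒᵖ V) (i : ℕ) (Φ : HeckeAlgebra K Δ →ₙ+* 𝔽)
    (f : TotalCohomology K α ρ i) : Prop :=
  f ≠ 0 ∧ ∀ T : HeckeAlgebra K Δ, heckeAction hΓ hΔ ρ i T f = Φ T • f

/-- The system of eigenvalues `Φ` occurs in `⨁_c Hⁱ(Γ_c, V)`. -/
def Occurs {α : ClassGroup (𝓞 F) → GL (Fin n) (AdeleRing (𝓞 F) F)}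
    (hΓ : ∀ c, ∀ g ∈ arithGroup K (α c), g ∈ S)
    (hΔ : ∀ c c', ∀ g ∈ arithSet Δ (α c) (α c'), g ∈ S)
    (ρ : Representation 𝔽 (↥S)ᵐᵒᵖ V) (i : ℕ) (Φ : HeckeAlgebra K Δ →ₙ+* 𝔽) : Prop :=
  ∃ f : TotalCohomology K α ρ i, IsEigenform hΓ hΔ ρ i Φ f

/-- `Ψ = χ ⊗ Φ`, that is, `Ψ(K δ K) = χ((det δ)) Φ(K δ K)` for all `δ ∈ Δ`. As `R(K, Δ)` is spanned
by the double cosets, there is at most one such `Ψ`. -/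
def IsTwist (hK : IsHeckePair K Δ) (χ : ClassGroup (𝓞 F) →* 𝔽ˣ)
    (Φ Ψ : HeckeAlgebra K Δ →ₙ+* 𝔽) : Prop :=
  ∀ (δ : GL (Fin n) (AdeleRing (𝓞 F) F)) (hδ : δ ∈ Δ),
    Ψ (HeckeAlgebra.doubleCoset hK hδ) = χ (detClass δ) * Φ (HeckeAlgebra.doubleCoset hK hδ)

end Adelic

end AdelicHecke

end

/-! Both the Hecke algebra and the cohomology are graded by the class group, and the action respects
the gradings; twisting by `χ` is the usual operation of a character of the grading group.

Since `(det κ)` is principal on `K`, the class of `det g` depends only on the coset `K g`, so each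
`T` is the sum of its parts `T_d` supported on class `d` (`sum_detPart`). As `detClass` is a
homomorphism, these parts multiply as in a graded ring (`detPart_mul_detPart`), hence `T ↦ ∑ χ(d)
Φ(T_d)` is again multiplicative. A double coset `K δ K` is homogeneous of degree `[det δ]`, so this
map is `χ ⊗ Φ`.

Give `Hⁱ(Γ_c, V)` the degree `[det α_c]`. An element `g` of `GL_n(F)` has principal determinant, so
`α_{c'} g α_c⁻¹` lies in the class `[det α_{c'}] [det α_c]⁻¹`. Hence `(f | T_d)_c` only involves
those `f_{c'}` with `[det α_{c'}] = d [det α_c]` (`component_detPart_eq_zero`). Scaling every `f_c`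
by `χ([det α_c]) = χ(c)^ε` therefore multiplies the eigenvalue of `T_d` by `χ(d)`; summing over `d`
gives the claim. -/

namespace AdelicHecke

/-! ### The ideal class of an idele and of a determinant. -/

section IdeleClass

open NumberField IsDedekindDomain

variable {F : Type*} [Field F] [NumberField F] {n : ℕ}

theorem valued_idele_ne_zero (x : (AdeleRing (𝓞 F) F)ˣ) (v : HeightOneSpectrum (𝓞 F)) :
    Valued.v ((x : AdeleRing (𝓞 F) F).2 v) ≠ 0 := by
  have h : IsUnit (x : AdeleRing (𝓞 F) F).2 :=
    x.isUnit.map (RingHom.snd (InfiniteAdeleRing F) (FiniteAdeleRing (𝓞 F) F))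
  exact (Valuation.ne_zero_iff _).2 ((FiniteAdeleRing.isUnit_iff.1 h).1 v)

theorem valued_idele_eventually_eq_one (x : (AdeleRing (𝓞 F) F)ˣ) :
    ∀ᶠ v : HeightOneSpectrum (𝓞 F) in Filter.cofinite,
      Valued.v ((x : AdeleRing (𝓞 F) F).2 v) = 1 := by
  have h : IsUnit (x : AdeleRing (𝓞 F) F).2 :=
    x.isUnit.map (RingHom.snd (InfiniteAdeleRing F) (FiniteAdeleRing (𝓞 F) F))
  exact (FiniteAdeleRing.isUnit_iff.1 h).2

/-- An idele is a local unit at almost all places. Without this finiteness the `finprod` in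
`ideleIdeal` would take its default value `1`. -/
theorem ideleIdeal_hasFiniteMulSupport (x : (AdeleRing (𝓞 F) F)ˣ) :
    (Function.mulSupport fun v : HeightOneSpectrum (𝓞 F) =>
      (Units.mk0 (v.asIdeal : FractionalIdeal (nonZeroDivisors (𝓞 F)) F)
        (FractionalIdeal.coeIdeal_ne_zero.2 v.ne_bot)) ^
          (-WithZero.log (Valued.v ((x : AdeleRing (𝓞 F) F).2 v)))).Finite := by
  refine Set.Finite.subset (valued_idele_eventually_eq_one x) fun v hv h => hv ?_
  replace h : Valued.v ((x : AdeleRing (𝓞 F) F).2 v) = 1 := h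
  simp only [h, WithZero.log_one, neg_zero, zpow_zero]

theorem ideleIdeal_mul (x y : (AdeleRing (𝓞 F) F)ˣ) :
    ideleIdeal (x * y) = ideleIdeal x * ideleIdeal y := by
  rw [ideleIdeal, ideleIdeal, ideleIdeal, ← finprod_mul_distrib
    (ideleIdeal_hasFiniteMulSupport x) (ideleIdeal_hasFiniteMulSupport y)]
  refine finprod_congr fun v => ?_
  have h : ((x * y : (AdeleRing (𝓞 F) F)ˣ) : AdeleRing (𝓞 F) F).2 v =
    (x : AdeleRing (𝓞 F) F).2 v * (y : AdeleRing (𝓞 F) F).2 v := rfl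
  -- `WithZero.log` sends `0` to `0`, so it turns products into sums only for non-zero valuations.
  rw [h, map_mul, WithZero.log_mul (valued_idele_ne_zero x v) (valued_idele_ne_zero y v),
    neg_add, zpow_add]

/-- The class of the ideal of an idele, as a homomorphism. -/
noncomputable def ideleClass : (AdeleRing (𝓞 F) F)ˣ →* ClassGroup (𝓞 F) :=
  MonoidHom.mk' (fun x => ClassGroup.mk F (ideleIdeal x))
    fun x y => by rw [ideleIdeal_mul, map_mul]

/-- By unique factorization of `(r)` into primes, the ideal of the principal idele `r` is `(r)`
itself. -/
theorem ideleClass_integer (a : Fˣ) (r : 𝓞 F) (hr : (a : F) = r) :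
    ideleClass (Units.map (algebraMap F (AdeleRing (𝓞 F) F)).toMonoidHom a) = 1 := by
  have hr0 : r ≠ 0 := by
    rintro rfl
    exact a.ne_zero (hr.trans (map_zero _))
  have hI : (Ideal.span {r} : Ideal (𝓞 F)) ≠ 0 := by simpa using hr0
  have hval : ∀ v : HeightOneSpectrum (𝓞 F),
      -WithZero.log (Valued.v (((Units.map (algebraMap F (AdeleRing (𝓞 F) F)).toMonoidHom a :
        (AdeleRing (𝓞 F) F)ˣ) : AdeleRing (𝓞 F) F).2 v)) =
      ((Associates.mk v.asIdeal).count (Associates.mk (Ideal.span {r} : Ideal (𝓞 F))).factors : ℤ) := by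
    intro v
    have h : ((Units.map (algebraMap F (AdeleRing (𝓞 F) F)).toMonoidHom a :
        (AdeleRing (𝓞 F) F)ˣ) : AdeleRing (𝓞 F) F).2 v =
        ((a : F) : v.adicCompletion F) := rfl
    rw [h, HeightOneSpectrum.valuedAdicCompletion_eq_valuation', hr]
    erw [HeightOneSpectrum.valuation_of_algebraMap]
    -- The valuation is the exponential of minus the multiplicity; the sign in `ideleIdeal` cancels
    -- this minus.
    rw [v.intValuation_if_neg hr0, WithZero.log_exp, neg_neg]
  change ClassGroup.mk F (ideleIdeal _) = 1
  rw [ClassGroup.mk_eq_one_iff]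
  have hfin : ((ideleIdeal (Units.map (algebraMap F (AdeleRing (𝓞 F) F)).toMonoidHom a) :
      (FractionalIdeal (nonZeroDivisors (𝓞 F)) F)ˣ) : FractionalIdeal (nonZeroDivisors (𝓞 F)) F) =
      ((Ideal.span {r} : Ideal (𝓞 F)) : FractionalIdeal (nonZeroDivisors (𝓞 F)) F) := by
    rw [← Ideal.finprod_heightOneSpectrum_factorization_coe F hI, ideleIdeal,
      ← Units.coeHom_apply, MonoidHom.map_finprod _ (ideleIdeal_hasFiniteMulSupport _)]
    refine finprod_congr fun v => ?_
    rw [hval, Units.coeHom_apply, Units.val_zpow_eq_zpow_val, Units.val_mk0]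
  rw [hfin, FractionalIdeal.coe_coeIdeal, IsFractionRing.coeSubmodule_isPrincipal]
  exact ⟨r, rfl⟩

/-- Follows from the integral case by writing `a` as a quotient of two integers. -/
theorem ideleClass_algebraMap (a : Fˣ) :
    ideleClass (Units.map (algebraMap F (AdeleRing (𝓞 F) F)).toMonoidHom a) = 1 := by
  obtain ⟨r, s, hs, hrs⟩ := IsFractionRing.div_surjective (A := 𝓞 F) (a : F)
  have hs0 : (algebraMap (𝓞 F) F s) ≠ 0 := by
    simpa using nonZeroDivisors.ne_zero hs
  have hr0 : (algebraMap (𝓞 F) F r) ≠ 0 := by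
    intro h
    rw [h, zero_div] at hrs
    exact a.ne_zero hrs.symm
  have ha : a = Units.mk0 _ hr0 * (Units.mk0 _ hs0)⁻¹ := by
    ext
    simp [← hrs, div_eq_mul_inv]
  rw [ha, map_mul, map_mul, map_inv, map_inv, ideleClass_integer _ r rfl,
    ideleClass_integer _ s rfl, inv_one, mul_one]

theorem detClass_eq_ideleClass (δ : GL (Fin n) (AdeleRing (𝓞 F) F)) :
    detClass δ = ideleClass (Matrix.GeneralLinearGroup.det δ) := rfl

theorem detClass_mul (δ δ' : GL (Fin n) (AdeleRing (𝓞 F) F)) :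
    detClass (δ * δ') = detClass δ * detClass δ' := by
  simp [detClass_eq_ideleClass]

theorem detClass_inv (δ : GL (Fin n) (AdeleRing (𝓞 F) F)) :
    detClass δ⁻¹ = (detClass δ)⁻¹ := by
  simp [detClass_eq_ideleClass]

theorem detClass_diagGL (g : GL (Fin n) F) : detClass (diagGL F n g) = 1 := by
  rw [detClass_eq_ideleClass, Matrix.GeneralLinearGroup.map_det]
  exact ideleClass_algebraMap _

end IdeleClass

/-! ### Additivity of the Hecke operators in `T`. -/

section HeckeOpAdditive

variable {G : Type*} [Group G] {𝔽 : Type*} [Field 𝔽] {V : Type*} [AddCommGroup V] [Module 𝔽 V]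
  {S : Submonoid G} {Γ Γ' : Subgroup G} {Δ : Set G}

/-- The supports of `T`, `U` and `T + U` differ, so comparing their operators requires sums over a
common larger set of cosets. -/
theorem heckeFun_apply_of_subset (ρ : Representation 𝔽 (↥S)ᵐᵒᵖ V) (T : heckeModule Γ Γ' Δ) (i : ℕ)
    (f : Functions Γ V i) (γ' : Fin (i + 1) → Γ') {s : Finset (Cosets Γ)}
    (hs : heckeModule.support T ⊆ s) :
    heckeFun ρ T i f γ' = ∑ x ∈ s,
      T.1 x.out • act ρ x.out (f fun k => transfer Γ x (γ' k)) := by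
  rw [heckeFun_apply]
  refine Finset.sum_subset hs fun x _ hx => ?_
  rw [heckeModule.mem_support, not_not] at hx
  rw [hx, zero_smul]

theorem heckeFun_add (ρ : Representation 𝔽 (↥S)ᵐᵒᵖ V) (T U : heckeModule Γ Γ' Δ) (i : ℕ) :
    heckeFun ρ (T + U) i = heckeFun ρ T i + heckeFun ρ U i := by
  classical
  refine LinearMap.ext fun f => funext fun γ' => ?_
  let s := heckeModule.support T ∪ heckeModule.support U ∪ heckeModule.support (T + U)
  rw [LinearMap.add_apply, Pi.add_apply,
    heckeFun_apply_of_subset ρ (T + U) i f γ' (s := s) Finset.subset_union_right,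
    heckeFun_apply_of_subset ρ T i f γ' (s := s)
      (Finset.subset_union_left.trans Finset.subset_union_left),
    heckeFun_apply_of_subset ρ U i f γ' (s := s)
      (Finset.subset_union_right.trans Finset.subset_union_left), ← Finset.sum_add_distrib]
  exact Finset.sum_congr rfl fun x _ => add_smul _ _ _

theorem heckeOp_add (hΓ : ∀ g ∈ Γ, g ∈ S) (hΓ' : ∀ g ∈ Γ', g ∈ S) (hΔ : ∀ g ∈ Δ, g ∈ S)
    (ρ : Representation 𝔽 (↥S)ᵐᵒᵖ V) (T U : heckeModule Γ Γ' Δ) (i : ℕ) :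
    heckeOp hΓ hΓ' hΔ ρ (T + U) i = heckeOp hΓ hΓ' hΔ ρ T i + heckeOp hΓ hΓ' hΔ ρ U i := by
  refine LinearMap.ext fun f => ?_
  obtain ⟨f, rfl⟩ := Submodule.Quotient.mk_surjective _ f
  refine congrArg (Submodule.Quotient.mk) (Subtype.ext ?_)
  exact LinearMap.congr_fun (heckeFun_add ρ T U i) f.1

theorem heckeOp_zero (hΓ : ∀ g ∈ Γ, g ∈ S) (hΓ' : ∀ g ∈ Γ', g ∈ S) (hΔ : ∀ g ∈ Δ, g ∈ S)
    (ρ : Representation 𝔽 (↥S)ᵐᵒᵖ V) (i : ℕ) :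
    heckeOp hΓ hΓ' hΔ ρ (0 : heckeModule Γ Γ' Δ) i = 0 := by
  simpa using heckeOp_add hΓ hΓ' hΔ ρ (0 : heckeModule Γ Γ' Δ) 0 i

end HeckeOpAdditive

/-! ### The grading of the Hecke algebra by the class group. -/

section Twist

open NumberField IsDedekindDomain

variable {F : Type*} [Field F] [NumberField F] {n : ℕ}
  {K : Subgroup (GL (Fin n) (AdeleRing (𝓞 F) F))}
  {Δ : Subsemigroup (GL (Fin n) (AdeleRing (𝓞 F) F))}

open Classical in
/-- The part of `T = ∑ a_j K δ_j` that consists of the `K δ_j` with `(det δ_j)` in the class `c`. -/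
noncomputable def detPart (hprin : ∀ κ ∈ K, detClass κ = 1) (c : ClassGroup (𝓞 F)) :
    HeckeAlgebra K Δ →+ HeckeAlgebra K Δ :=
  AddMonoidHom.mk' (fun T => ⟨fun g => if detClass g = c then T.coeff g else 0, by
    have hsub : ∀ g, (if detClass g = c then T.coeff g else 0) ≠ 0 → T.coeff g ≠ 0 :=
      fun g hg h => hg (by rw [h, ite_self])
    refine ⟨fun κ hκ g => ?_, fun g κ hκ => ?_, fun g hg => ?_, ?_⟩
    · beta_reduce
      -- Truncation by class keeps the `K`-invariance exactly because elements of `K` have trivial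
      -- class.
      rw [detClass_mul, hprin κ hκ, one_mul, T.coeff_left hκ]
    · beta_reduce
      rw [detClass_mul, hprin κ hκ, mul_one, T.coeff_right hκ]
    · exact heckeModule.mem_of_ne_zero (Γ := K) (Γ' := K) T (hsub g hg)
    · exact T.2.2.2.2.subset (Set.image_mono hsub)⟩)
  fun T U => HeckeAlgebra.ext fun g => by
    change (if detClass g = c then (T + U).coeff g else 0) =
      (if detClass g = c then T.coeff g else 0) + (if detClass g = c then U.coeff g else 0)
    split_ifs
    · rfl
    · rfl

open Classical in
theorem coeff_detPart (hprin : ∀ κ ∈ K, detClass κ = 1) (c : ClassGroup (𝓞 F))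
    (T : HeckeAlgebra K Δ) (g : GL (Fin n) (AdeleRing (𝓞 F) F)) :
    (detPart hprin c T).coeff g = if detClass g = c then T.coeff g else 0 := rfl

theorem sum_detPart (hprin : ∀ κ ∈ K, detClass κ = 1) (T : HeckeAlgebra K Δ) :
    ∑ c, detPart hprin c T = T := by
  classical
  refine HeckeAlgebra.ext fun g => ?_
  let coeffHom : HeckeAlgebra K Δ →+ ℤ :=
    AddMonoidHom.mk' (fun U => U.coeff g) fun _ _ => rfl
  change coeffHom _ = T.coeff g
  rw [map_sum]
  change ∑ c, (if detClass g = c then T.coeff g else 0) = T.coeff g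
  simp

/-- Classes multiply along `K δ δ'`, so against a right factor of degree `d` only the degree `c`
part of `T` contributes in degree `c d`. Leaving the left factor of the first product whole means
that only `U` has to be decomposed in `twist`. -/
theorem detPart_mul_detPart (hprin : ∀ κ ∈ K, detClass κ = 1) (c d : ClassGroup (𝓞 F))
    (T U : HeckeAlgebra K Δ) :
    detPart hprin (c * d) (T * detPart hprin d U) = detPart hprin c T * detPart hprin d U := by
  classical
  refine HeckeAlgebra.ext fun g => ?_
  have hterm : ∀ x : Cosets K,
      (detPart hprin c T).coeff (g * x.out⁻¹) * (detPart hprin d U).coeff x.out =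
      if detClass g = c * d then T.coeff (g * x.out⁻¹) * (detPart hprin d U).coeff x.out else 0 := by
    intro x
    rw [coeff_detPart, coeff_detPart, detClass_mul, detClass_inv]
    -- Off class `d` the right factor vanishes; on it, `g x⁻¹` has class `c` exactly when `g` has
    -- class `c d`.
    by_cases hx : detClass x.out = d
    · simp only [hx, mul_inv_eq_iff_eq_mul, if_true, ite_mul, zero_mul]
    · simp only [hx, if_false, mul_zero, ite_self]
  rw [coeff_detPart, HeckeAlgebra.coeff_mul, HeckeAlgebra.coeff_mul, finsum_congr hterm]
  split_ifs
  · rfl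
  · rw [finsum_zero]

/-- All of `K δ K` lies in the class of `det δ`, so a double coset is homogeneous. -/
theorem detPart_doubleCoset (hK : IsHeckePair K Δ) (hprin : ∀ κ ∈ K, detClass κ = 1)
    {δ : GL (Fin n) (AdeleRing (𝓞 F) F)} (hδ : δ ∈ Δ) (c : ClassGroup (𝓞 F))
    [Decidable (detClass δ = c)] :
    detPart hprin c (HeckeAlgebra.doubleCoset hK hδ) =
      if detClass δ = c then HeckeAlgebra.doubleCoset hK hδ else 0 := by
  have hcl : ∀ g, (HeckeAlgebra.doubleCoset hK hδ).coeff g ≠ 0 → detClass g = detClass δ := by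
    intro g hg
    obtain ⟨x, hx, y, hy, rfl⟩ := DoubleCoset.mem_doubleCoset.1 (Set.mem_of_indicator_ne_zero hg)
    rw [detClass_mul, detClass_mul, hprin x hx, hprin y hy, one_mul, mul_one]
  refine HeckeAlgebra.ext fun g => ?_
  rw [coeff_detPart]
  by_cases hg : (HeckeAlgebra.doubleCoset hK hδ).coeff g = 0
  · rw [hg, ite_self]
    split_ifs
    · exact hg.symm
    · rfl
  · rw [hcl g hg]
    split_ifs
    · rfl
    · rfl

/-! ### The twisted system of eigenvalues. -/

variable {𝔽 : Type*} [Field 𝔽]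

/-- The system of eigenvalues `χ ⊗ Φ`. -/
noncomputable def twist (hprin : ∀ κ ∈ K, detClass κ = 1) (χ : ClassGroup (𝓞 F) →* 𝔽ˣ)
    (Φ : HeckeAlgebra K Δ →ₙ+* 𝔽) : HeckeAlgebra K Δ →ₙ+* 𝔽 where
  toFun T := ∑ c, (χ c : 𝔽) * Φ (detPart hprin c T)
  map_zero' := by simp
  map_add' T U := by simp [mul_add, Finset.sum_add_distrib]
  map_mul' T U := by
    -- Multiplicativity for a right factor of degree `d`: substitute `c d` for `c` and use `χ(c d) =
    -- χ(c) χ(d)`.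
    have hpart : ∀ d, ∑ c, (χ c : 𝔽) * Φ (detPart hprin c (T * detPart hprin d U)) =
        (∑ c, (χ c : 𝔽) * Φ (detPart hprin c T)) * ((χ d : 𝔽) * Φ (detPart hprin d U)) := by
      intro d
      rw [Finset.sum_mul, ← Equiv.sum_comp (Equiv.mulRight d)]
      refine Finset.sum_congr rfl fun c _ => ?_
      rw [Equiv.coe_mulRight, detPart_mul_detPart, map_mul, map_mul, Units.val_mul]
      ring
    conv_lhs => rw [← sum_detPart hprin U]
    simp only [Finset.mul_sum, map_sum]
    rw [Finset.sum_comm]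
    simp only [← hpart]

theorem twist_apply (hprin : ∀ κ ∈ K, detClass κ = 1) (χ : ClassGroup (𝓞 F) →* 𝔽ˣ)
    (Φ : HeckeAlgebra K Δ →ₙ+* 𝔽) (T : HeckeAlgebra K Δ) :
    twist hprin χ Φ T = ∑ c, (χ c : 𝔽) * Φ (detPart hprin c T) := rfl

theorem isTwist_twist (hK : IsHeckePair K Δ) (hprin : ∀ κ ∈ K, detClass κ = 1)
    (χ : ClassGroup (𝓞 F) →* 𝔽ˣ) (Φ : HeckeAlgebra K Δ →ₙ+* 𝔽) :
    IsTwist hK χ Φ (twist hprin χ Φ) := by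
  classical
  intro δ hδ
  rw [twist_apply, Finset.sum_eq_single (detClass δ)]
  · rw [detPart_doubleCoset, if_pos rfl]
  · intro c _ hc
    rw [detPart_doubleCoset, if_neg hc.symm, map_zero, mul_zero]
  · simp

/-! ### Compatibility of the Hecke action with the grading. -/

theorem component_add (T U : HeckeAlgebra K Δ) (a b : GL (Fin n) (AdeleRing (𝓞 F) F)) :
    component (T + U) a b = component T a b + component U a b := rfl

/-- Elements of `GL_n(F)` have trivial class, so every `a g b⁻¹` has the class of `a b⁻¹`; a part of
any other degree has no coefficient there. -/
theorem component_detPart_eq_zero (hprin : ∀ κ ∈ K, detClass κ = 1) (T : HeckeAlgebra K Δ)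
    {a b : GL (Fin n) (AdeleRing (𝓞 F) F)} {d : ClassGroup (𝓞 F)}
    (h : detClass a ≠ d * detClass b) : component (detPart hprin d T) a b = 0 := by
  refine Subtype.ext (funext fun g => ?_)
  change (detPart hprin d T).coeff (a * diagGL F n g * b⁻¹) = 0
  rw [coeff_detPart, if_neg]
  rw [detClass_mul, detClass_mul, detClass_diagGL, detClass_inv, mul_one, mul_inv_eq_iff_eq_mul]
  exact h

variable {V : Type*} [AddCommGroup V] [Module 𝔽 V] {S : Submonoid (GL (Fin n) F)}
  {α : ClassGroup (𝓞 F) → GL (Fin n) (AdeleRing (𝓞 F) F)}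

theorem heckeAction_apply (hΓ : ∀ c, ∀ g ∈ arithGroup K (α c), g ∈ S)
    (hΔ : ∀ c c', ∀ g ∈ arithSet Δ (α c) (α c'), g ∈ S)
    (ρ : Representation 𝔽 (↥S)ᵐᵒᵖ V) (i : ℕ) (T : HeckeAlgebra K Δ)
    (f : TotalCohomology K α ρ i) (c : ClassGroup (𝓞 F)) :
    heckeAction hΓ hΔ ρ i T f c = ∑ c', heckeOp (hΓ c') (hΓ c) (hΔ c' c) ρ
      (component T (α c') (α c)) i (f c') := by
  simp [heckeAction, LinearMap.sum_apply]

theorem heckeAction_add (hΓ : ∀ c, ∀ g ∈ arithGroup K (α c), g ∈ S)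
    (hΔ : ∀ c c', ∀ g ∈ arithSet Δ (α c) (α c'), g ∈ S)
    (ρ : Representation 𝔽 (↥S)ᵐᵒᵖ V) (i : ℕ) (T U : HeckeAlgebra K Δ) :
    heckeAction hΓ hΔ ρ i (T + U) = heckeAction hΓ hΔ ρ i T + heckeAction hΓ hΔ ρ i U := by
  refine LinearMap.ext fun f => funext fun c => ?_
  rw [LinearMap.add_apply, Pi.add_apply, heckeAction_apply, heckeAction_apply, heckeAction_apply,
    ← Finset.sum_add_distrib]
  refine Finset.sum_congr rfl fun c' _ => ?_
  rw [component_add, heckeOp_add, LinearMap.add_apply]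

theorem heckeAction_zero (hΓ : ∀ c, ∀ g ∈ arithGroup K (α c), g ∈ S)
    (hΔ : ∀ c c', ∀ g ∈ arithSet Δ (α c) (α c'), g ∈ S)
    (ρ : Representation 𝔽 (↥S)ᵐᵒᵖ V) (i : ℕ) :
    heckeAction hΓ hΔ ρ i (0 : HeckeAlgebra K Δ) = 0 := by
  refine LinearMap.ext fun f => funext fun c => ?_
  rw [heckeAction_apply]
  refine Finset.sum_eq_zero fun c' _ => ?_
  exact LinearMap.congr_fun (heckeOp_zero (hΓ c') (hΓ c) (hΔ c' c) ρ i) (f c')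

theorem heckeAction_eq_sum_detPart (hprin : ∀ κ ∈ K, detClass κ = 1)
    (hΓ : ∀ c, ∀ g ∈ arithGroup K (α c), g ∈ S)
    (hΔ : ∀ c c', ∀ g ∈ arithSet Δ (α c) (α c'), g ∈ S)
    (ρ : Representation 𝔽 (↥S)ᵐᵒᵖ V) (i : ℕ) (T : HeckeAlgebra K Δ) :
    heckeAction hΓ hΔ ρ i T = ∑ d, heckeAction hΓ hΔ ρ i (detPart hprin d T) := by
  conv_lhs => rw [← sum_detPart hprin T]
  let φ : HeckeAlgebra K Δ →+ (TotalCohomology K α ρ i →ₗ[𝔽] TotalCohomology K α ρ i) :=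
    { toFun := heckeAction hΓ hΔ ρ i
      map_zero' := heckeAction_zero hΓ hΔ ρ i
      map_add' := heckeAction_add hΓ hΔ ρ i }
  exact map_sum φ _ _

/-- In each surviving term `[det α_{c'}] = d [det α_c]`, so the scalar on `f_{c'}` is the same for
all of them and comes out of the sum. -/
theorem heckeAction_detPart_twist (hprin : ∀ κ ∈ K, detClass κ = 1)
    (hΓ : ∀ c, ∀ g ∈ arithGroup K (α c), g ∈ S)
    (hΔ : ∀ c c', ∀ g ∈ arithSet Δ (α c) (α c'), g ∈ S)
    (ρ : Representation 𝔽 (↥S)ᵐᵒᵖ V) (i : ℕ) (χ : ClassGroup (𝓞 F) →* 𝔽ˣ)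
    (d : ClassGroup (𝓞 F)) (T : HeckeAlgebra K Δ) (f : TotalCohomology K α ρ i)
    (c : ClassGroup (𝓞 F)) :
    heckeAction hΓ hΔ ρ i (detPart hprin d T) (fun c => (χ (detClass (α c)) : 𝔽) • f c) c =
      ((χ d : 𝔽) * χ (detClass (α c))) • heckeAction hΓ hΔ ρ i (detPart hprin d T) f c := by
  rw [heckeAction_apply, heckeAction_apply, Finset.smul_sum]
  refine Finset.sum_congr rfl fun c' _ => ?_
  by_cases h : detClass (α c') = d * detClass (α c)
  · rw [h, map_smul, map_mul, Units.val_mul]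
  · rw [component_detPart_eq_zero hprin T h, heckeOp_zero, LinearMap.zero_apply,
      LinearMap.zero_apply, smul_zero]

theorem IsEigenform.twist {hprin : ∀ κ ∈ K, detClass κ = 1}
    {hΓ : ∀ c, ∀ g ∈ arithGroup K (α c), g ∈ S}
    {hΔ : ∀ c c', ∀ g ∈ arithSet Δ (α c) (α c'), g ∈ S}
    {ρ : Representation 𝔽 (↥S)ᵐᵒᵖ V} {i : ℕ} (χ : ClassGroup (𝓞 F) →* 𝔽ˣ)
    {Φ : HeckeAlgebra K Δ →ₙ+* 𝔽} {f : TotalCohomology K α ρ i}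
    (hf : IsEigenform hΓ hΔ ρ i Φ f) :
    IsEigenform hΓ hΔ ρ i (twist hprin χ Φ) (fun c => (χ (detClass (α c)) : 𝔽) • f c) := by
  refine ⟨fun h => hf.1 (funext fun c => ?_), fun T => funext fun c => ?_⟩
  -- The scaling factors are units, so scaling cannot kill a non-zero `f`.
  · exact (smul_eq_zero.1 (congrFun h c)).resolve_left (Units.ne_zero _)
  · rw [heckeAction_eq_sum_detPart hprin, LinearMap.sum_apply, Finset.sum_apply, Pi.smul_apply,
      twist_apply, Finset.sum_smul]
    refine Finset.sum_congr rfl fun d _ => ?_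
    -- The eigenform equation is applied to each homogeneous part of `T`, itself an element of the
    -- Hecke algebra.
    rw [heckeAction_detPart_twist, hf.2, Pi.smul_apply, smul_smul, smul_smul]
    congr 1
    ring

end Twist

end AdelicHecke

theorem mainTheorem6
    {F : Type*} [Field F] [NumberField F] (n : ℕ)
    {𝔽 : Type*} [Field 𝔽] {V : Type*} [AddCommGroup V] [Module 𝔽 V]
    -- the Hecke pair `(K, Δ)` in `GL_n(𝔸)`, with `(det κ)` principal for all `κ ∈ K`
    (K : Subgroup (GL (Fin n) (NumberField.AdeleRing (NumberField.RingOfIntegers F) F)))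
    (Δ : Subsemigroup (GL (Fin n) (NumberField.AdeleRing (NumberField.RingOfIntegers F) F)))
    (hK : AdelicHecke.IsHeckePair K Δ)
    (hprin : ∀ κ ∈ K, AdelicHecke.detClass κ = 1)
    -- the elements `α_c`, with `(det α_c)` in the class `c ^ ε`, where `ε` is `1` or `-1`
    (α : ClassGroup (NumberField.RingOfIntegers F) →
      GL (Fin n) (NumberField.AdeleRing (NumberField.RingOfIntegers F) F))
    (ε : ℤˣ) (hα : ∀ c, AdelicHecke.detClass (α c) = c ^ (ε : ℤ))
    -- the determinant maps the union of the `α_c GL_n(F) K` onto `GL_1(𝔸)`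
    (hdet : ∀ x : (NumberField.AdeleRing (NumberField.RingOfIntegers F) F)ˣ,
      ∃ c, ∃ g : GL (Fin n) F, ∃ κ ∈ K,
        Matrix.GeneralLinearGroup.det (α c * AdelicHecke.diagGL F n g * κ) = x)
    -- the right module `V` for a monoid `S` that contains all `Γ_c` and `Δ_{c,c'}`
    (S : Submonoid (GL (Fin n) F))
    (hΓ : ∀ c, ∀ g ∈ AdelicHecke.arithGroup K (α c), g ∈ S)
    (hΔ : ∀ c c', ∀ g ∈ AdelicHecke.arithSet Δ (α c) (α c'), g ∈ S)
    (ρ : Representation 𝔽 (↥S)ᵐᵒᵖ V) (i : ℕ)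
    (χ : ClassGroup (NumberField.RingOfIntegers F) →* 𝔽ˣ)
    (Φ : AdelicHecke.HeckeAlgebra K Δ →ₙ+* 𝔽)
    (hΦ : AdelicHecke.Occurs hΓ hΔ ρ i Φ) :
    ∃ Ψ : AdelicHecke.HeckeAlgebra K Δ →ₙ+* 𝔽,
      AdelicHecke.IsTwist hK χ Φ Ψ ∧
      AdelicHecke.Occurs hΓ hΔ ρ i Ψ ∧
      ∀ f : AdelicHecke.TotalCohomology K α ρ i, AdelicHecke.IsEigenform hΓ hΔ ρ i Φ f →
        AdelicHecke.IsEigenform hΓ hΔ ρ i Ψ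
          (fun c => ((χ c ^ (ε : ℤ) : 𝔽ˣ) : 𝔽) • f c) := by 
  -- The sign `ε` enters only here: in terms of the class of `det α_c`, the scaling factor is the
  -- same for both signs.
  have hχ : ∀ c, (χ c ^ (ε : ℤ) : 𝔽ˣ) = χ (AdelicHecke.detClass (α c)) := fun c => by
    rw [hα, map_zpow]
  simp only [hχ]
  obtain ⟨f, hf⟩ := hΦ
  exact ⟨AdelicHecke.twist hprin χ Φ, AdelicHecke.isTwist_twist hK hprin χ Φ,
    ⟨_, hf.twist χ⟩, fun f hf => hf.twist χ⟩
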